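/- All elliptic curves are given by Weierstrass equations $y^2+a_1xy+a_3y=x^3+a_2x^2+a_4x+a_6$ over $\mathbb{Q}$, with the usual invariants $c_4,c_6,\Delta$. Such an equation is \emph{(global) minimal} if its coefficients are integers and, for every prime $p$, $v_p(\Delta)$ is the least possible among all equations with $p$-integral coefficients obtained from it by a change of variables over $\mathbb{Q}$. Here $v_p$ is the $p$-adic valuation on $\mathbb{Q}$, with $v_p(0)=\infty$. For $u\in\mathbb{Q}^\times$ and $r,s,t\in\mathbb{Q}$, the change of variables $[u,r,s,t]$ is $x=u^2x'+r$, $y=u^3y'+u^2sx'+t$. Let $E$ be an elliptic curve over $\mathbb{Q}$ given by a minimal equation with coefficients $a_i$, and let $d$ be a square-free integer. Let $E^d$ be the quadratic twist of $E$ by $d$, given by Connell's equation $$y^2+a_1xy+a_3y=x^3+\Big(a_2d+a_1^2\tfrac{d-1}{4}\Big)x^2+\Big(a_4d^2+a_1a_3\tfrac{d^2-1}{2}\Big)x+\Big(a_6d^3+a_3^2\tfrac{d^3-1}{4}\Big).$$ For a prime $p$ put $\lambda_p=\min\{3v_p(c_4(E)),\,2v_p(c_6(E)),\,v_p(\Delta(E))\}$,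 and call $(v_p(c_4(E)),v_p(c_6(E)),v_p(\Delta(E)))$ the $p$-adic signature of $E$. Define $u_p$ as follows. 1. Let $p$ be odd. If $p\nmid d$, then $u_p=1$. If $p\mid d$, then: (a) if $\lambda_p<6$, or if $p=3$ and $v_3(c_6(E))=5$, then $u_p=1$; (b) otherwise $u_p=p$. 2. Let $p=2$. (a) If $d\equiv1\bmod 4$, then $u_2=1$. (b) If $d\equiv3\bmod4$, then: (i) if the $2$-adic signature of $E$ is $(0,0,c)$ with $c\ge0$, or $(a,3,0)$ with $4\le a\le\infty$, then $u_2=\tfrac12$; (ii) if the $2$-adic signature is $(4,6,c)$ with $c\ge12$ and $2^{-6}c_6(E)d\equiv-1\bmod4$, or $(a,9,12)$ with $8\le a\le\infty$ and $2^{-9}c_6(E)d\equiv1\bmod4$, then $u_2=2$; (iii) otherwise $u_2=1$. (c) If $d\equiv2\bmod4$, let $w=d/2$; then: (i) if the $2$-adic signature is $(0,0,c)$ with $c\ge0$, then $u_2=\tfrac12$; (ii) if the $2$-adic signature is $(6,9,c)$ with $c\ge18$ and $2^{-9}c_6(E)w\equiv-1\bmod4$, then $u_2=4$; (iii) if $v_2(c_4(E))\in\{4,5\}$,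 or $v_2(c_6(E))\in\{3,5,7\}$, or the $2$-adic signature is $(a,6,6)$ with $6\le a\le\infty$ and $2^{-6}c_6(E)w\equiv-1\bmod4$, then $u_2=1$; (iv) otherwise $u_2=2$. Let $\tilde u=\prod_pu_p$, the product over all primes $p$ (all but finitely many factors are $1$). Then there exist $r,s,t\in\mathbb{Q}$ such that the change of variables $[\tilde u,r,s,t]$ transforms the equation $E^d$ into a global minimal equation. -/

import Mathlib

namespace QuadraticTwist

/-- The `p`-adic valuations on `ℚ` are discrete: the ring `ℤ_(p)` of `p`-integral rationals is a
discrete valuation ring, with fraction field `ℚ`. -/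
instance padicValuationSubring_isDiscreteValuationRing (p : ℕ) [Fact p.Prime] :
    IsDiscreteValuationRing (Rat.padicValuation p).valuationSubring := by
  have : (Rat.padicValuation p).IsNontrivial := ⟨p, by simp, by
    rw [Rat.padicValuation_self]; decide⟩
  infer_instance

/-- A Weierstrass equation over `ℚ` is *global minimal* if its coefficients are integers and it is
a minimal Weierstrass equation at every prime `p`, i.e. among all the `p`-integral Weierstrass
equations related to it by a change of variables over `ℚ`, it has the least `v_p(Δ)`. -/
def IsGlobalMinimal (W : WeierstrassCurve ℚ) : Prop :=
  W.IsIntegral ℤ ∧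
    ∀ (p : ℕ) [Fact p.Prime], W.IsMinimal (Rat.padicValuation p).valuationSubring

/-- Connell's Weierstrass equation `E^d` for the quadratic twist of `E` by `d`. -/
def twist (E : WeierstrassCurve ℚ) (d : ℤ) : WeierstrassCurve ℚ where
  a₁ := E.a₁
  a₂ := E.a₂ * d + E.a₁ ^ 2 * ((d - 1) / 4)
  a₃ := E.a₃
  a₄ := E.a₄ * d ^ 2 + E.a₁ * E.a₃ * ((d ^ 2 - 1) / 2)
  a₆ := E.a₆ * d ^ 3 + E.a₃ ^ 2 * ((d ^ 3 - 1) / 4)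

/-- The standard `p`-adic valuation on `ℚ`, with `v_p(0) = ∞`. -/
def vp (p : ℕ) (x : ℚ) : WithTop ℤ :=
  if x = 0 then ⊤ else (padicValRat p x : ℤ)

/-- `λ_{v_p} = min {3 v_p(c₄), 2 v_p(c₆), v_p(Δ)}`. -/
def lam (E : WeierstrassCurve ℚ) (p : ℕ) : WithTop ℤ :=
  min (3 • vp p E.c₄) (min (2 • vp p E.c₆) (vp p E.Δ))

/-- The `p`-adic signature of `E` is `(a, b, c)`. -/
def HasSignature (E : WeierstrassCurve ℚ) (p : ℕ) (a b c : WithTop ℤ) : Prop :=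
  vp p E.c₄ = a ∧ vp p E.c₆ = b ∧ vp p E.Δ = c

open Classical in
/-- The local factor `u_p` at an odd prime `p`. -/
noncomputable def oddFactor (E : WeierstrassCurve ℚ) (d : ℤ) (p : ℕ) : ℚ :=
  if (p : ℤ) ∣ d then
    if lam E p < 6 ∨ (p = 3 ∧ vp p E.c₆ = 5) then 1 else p
  else 1

open Classical in
/-- The local factor `u_2` when `d ≡ 3 mod 4`. -/
noncomputable def twoFactorOfThreeModFour (E : WeierstrassCurve ℚ) (d : ℤ) : ℚ :=
  if (∃ c, 0 ≤ c ∧ HasSignature E 2 0 0 c) ∨ (∃ a, 4 ≤ a ∧ HasSignature E 2 a 3 0) then 1 / 2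
  else if
      (∃ c, 12 ≤ c ∧ HasSignature E 2 4 6 c ∧ E.c₆ / 2 ^ 6 * d ≡ -1 [PMOD (4 : ℚ)]) ∨
      (∃ a, 8 ≤ a ∧ HasSignature E 2 a 9 12 ∧ E.c₆ / 2 ^ 9 * d ≡ 1 [PMOD (4 : ℚ)]) then 2
  else 1

open Classical in
/-- The local factor `u_2` when `d ≡ 2 mod 4`; here `w = d / 2`. -/
noncomputable def twoFactorOfTwoModFour (E : WeierstrassCurve ℚ) (d : ℤ) : ℚ :=
  let w : ℚ := (d : ℚ) / 2
  if ∃ c, 0 ≤ c ∧ HasSignature E 2 0 0 c then 1 / 2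
  else if ∃ c, 18 ≤ c ∧ HasSignature E 2 6 9 c ∧ E.c₆ / 2 ^ 9 * w ≡ -1 [PMOD (4 : ℚ)] then 4
  else if (vp 2 E.c₄ = 4 ∨ vp 2 E.c₄ = 5) ∨
      (vp 2 E.c₆ = 3 ∨ vp 2 E.c₆ = 5 ∨ vp 2 E.c₆ = 7) ∨
      (∃ a, 6 ≤ a ∧ HasSignature E 2 a 6 6 ∧ E.c₆ / 2 ^ 6 * w ≡ -1 [PMOD (4 : ℚ)]) then 1
  else 2

open Classical in
/-- The local factor `u_p` at a prime `p`. (A square-free `d` is congruent to `1`, `2` or `3`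
modulo `4`, so the three cases for `p = 2` are exhaustive.) -/
noncomputable def localFactor (E : WeierstrassCurve ℚ) (d : ℤ) (p : ℕ) : ℚ :=
  if p = 2 then
    if d ≡ 1 [ZMOD 4] then 1
    else if d ≡ 3 [ZMOD 4] then twoFactorOfThreeModFour E d
    else twoFactorOfTwoModFour E d
  else oddFactor E d p

/-- All but finitely many of the local factors are `1`. -/
theorem finite_mulSupport_localFactor (E : WeierstrassCurve ℚ) {d : ℤ} (hd : d ≠ 0) :
    (Function.mulSupport fun p : Nat.Primes => localFactor E d p).Finite := by
  refine Set.Finite.of_finite_image (f := fun p : Nat.Primes => (p : ℕ))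
    ((Set.finite_Iic (2 + d.natAbs)).subset ?_) Subtype.val_injective.injOn
  rintro _ ⟨p, hp, rfl⟩
  by_contra hlt
  simp only [Set.mem_Iic, not_le] at hlt
  refine hp ?_
  have h2 : (p : ℕ) ≠ 2 := by omega
  have hnd : ¬ ((p : ℕ) : ℤ) ∣ d := fun h => by
    have := Nat.le_of_dvd (Int.natAbs_pos.mpr hd) (Int.natCast_dvd.mp h)
    omega
  simp [localFactor, oddFactor, h2, hnd]

/-- `ũ = ∏_p u_p`, the product over all primes `p`. -/
noncomputable def uTilde (E : WeierstrassCurve ℚ) (d : ℤ) : ℚ :=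
  ∏ᶠ p : Nat.Primes, localFactor E d p

end QuadraticTwist

/-!
By Kraus, integers `c₄, c₆, Δ` with `1728 Δ = c₄³ - c₆²` are the invariants of an integral
Weierstrass equation iff they satisfy a congruence at `2` and one at `3`. Hence an integral
equation is minimal at `p` iff its invariants, when divided by `(p⁴, p⁶, p¹²)`, stop being integral
or violate the congruence at `p`; minimality becomes a property of the triple `T = (c₄, c₆, Δ)`.

Twisting by `d` multiplies `T` by `(d², d³, d⁶)`, while a change of variables with scaling factor
`n` divides it by `(n⁴, n⁶, n¹²)`, so undoes the twist by `n²`. Write `d = g w` with `g ∈ {1, p}`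
and `w` prime to `p`, and let `n` be a power of `p`. The twist of `T` by `d` can be divided by
`(n⁴, n⁶, n¹²)` iff `T` is the twist by `n² / g` of some `S` whose twist by `w` still satisfies the
congruence at `p`, which is what the cases in the definition of `u_p` detect. Since every twist by
a multiple of `p` (of `4` if `p = 2`) satisfies the congruence at `p`, the minimality of `T` bounds
`n`, and only finitely many cases remain. Finally `ũ / u_p` is a `p`-adic unit, so the scaling
factor `ũ` achieves minimality at all primes at once.
-/

namespace QuadraticTwist

/-- The invariants `(c₄, c₆, Δ)` of a Weierstrass equation, as a triple subject only to the
relation between them. -/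
@[ext]
structure Invariants (R : Type*) [CommRing R] where
  c₄ : R
  c₆ : R
  Δ : R
  relation : 1728 * Δ = c₄ ^ 3 - c₆ ^ 2

namespace Invariants

variable {R S : Type*} [CommRing R] [CommRing S]

/-- Twisting by `w` multiplies `(c₄, c₆, Δ)` by `(w², w³, w⁶)`; a change of variables with scaling
factor `u⁻¹` is the twist by `u²`. -/
instance : MulAction R (Invariants R) where
  smul w T := ⟨w ^ 2 * T.c₄, w ^ 3 * T.c₆, w ^ 6 * T.Δ, by linear_combination w ^ 6 * T.relation⟩
  one_smul T := Invariants.ext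
    ((congrArg (· * T.c₄) (one_pow 2)).trans (one_mul _))
    ((congrArg (· * T.c₆) (one_pow 3)).trans (one_mul _))
    ((congrArg (· * T.Δ) (one_pow 6)).trans (one_mul _))
  mul_smul v w T := Invariants.ext
    ((congrArg (· * T.c₄) (mul_pow v w 2)).trans (mul_assoc _ _ _))
    ((congrArg (· * T.c₆) (mul_pow v w 3)).trans (mul_assoc _ _ _))
    ((congrArg (· * T.Δ) (mul_pow v w 6)).trans (mul_assoc _ _ _))

@[simp] theorem smul_c₄ (w : R) (T : Invariants R) : (w • T).c₄ = w ^ 2 * T.c₄ := rfl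

@[simp] theorem smul_c₆ (w : R) (T : Invariants R) : (w • T).c₆ = w ^ 3 * T.c₆ := rfl

@[simp] theorem smul_Δ (w : R) (T : Invariants R) : (w • T).Δ = w ^ 6 * T.Δ := rfl

/-- The image of a triple of invariants under a ring homomorphism. -/
@[simps]
def map (f : R →+* S) (T : Invariants R) : Invariants S where
  c₄ := f T.c₄
  c₆ := f T.c₆
  Δ := f T.Δ
  relation := by simpa only [map_mul, map_ofNat, map_sub, map_pow] using congrArg f T.relation

protected theorem map_smul (f : R →+* S) (w : R) (T : Invariants R) :
    (w • T).map f = f w • T.map f := by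
  ext <;> simp

theorem map_injective {f : R →+* S} (hf : Function.Injective f) :
    Function.Injective (map f) := fun _ _ h => Invariants.ext
  (hf (congrArg c₄ h)) (hf (congrArg c₆ h)) (hf (congrArg Δ h))

/-- The invariants of a Weierstrass equation. -/
@[simps]
def ofCurve (W : WeierstrassCurve R) : Invariants R where
  c₄ := W.c₄
  c₆ := W.c₆
  Δ := W.Δ
  relation := W.c_relation

theorem ofCurve_map (f : R →+* S) (W : WeierstrassCurve R) :
    ofCurve (W.map f) = (ofCurve W).map f := by
  ext <;> simp

theorem ofCurve_eq_smul_variableChange (C : WeierstrassCurve.VariableChange R)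
    (W : WeierstrassCurve R) : ofCurve W = (C.u : R) ^ 2 • ofCurve (C • W) := by
  ext <;> simp [WeierstrassCurve.variableChange_c₄, WeierstrassCurve.variableChange_c₆,
    WeierstrassCurve.variableChange_Δ, ← mul_assoc, ← pow_mul, ← mul_pow]

variable [IsDomain R]

theorem smul_right_injective {m : R} (hm : m ≠ 0) :
    Function.Injective (m • · : Invariants R → Invariants R) := fun _ _ h => Invariants.ext
  (mul_left_cancel₀ (pow_ne_zero 2 hm) (congrArg c₄ h))
  (mul_left_cancel₀ (pow_ne_zero 3 hm) (congrArg c₆ h))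
  (mul_left_cancel₀ (pow_ne_zero 6 hm) (congrArg Δ h))

theorem exists_eq_smul_iff {m : R} (hm : m ≠ 0) {T : Invariants R} :
    (∃ T', T = m • T') ↔ m ^ 2 ∣ T.c₄ ∧ m ^ 3 ∣ T.c₆ ∧ m ^ 6 ∣ T.Δ := by
  refine ⟨?_, fun ⟨⟨a, ha⟩, ⟨b, hb⟩, ⟨c, hc⟩⟩ => ?_⟩
  · rintro ⟨T', rfl⟩
    exact ⟨dvd_mul_right _ _, dvd_mul_right _ _, dvd_mul_right _ _⟩
  · refine ⟨⟨a, b, c, mul_left_cancel₀ (pow_ne_zero 6 hm) ?_⟩, Invariants.ext ha hb hc⟩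
    have := T.relation
    rw [ha, hb, hc] at this
    linear_combination this

theorem exists_smul_eq_of_isCoprime {m w : R} (hm : m ≠ 0) (hmw : IsCoprime m w)
    {T T' : Invariants R} (h : w • T = m • T') : ∃ S, T = m • S ∧ T' = w • S := by
  have hdvd {k : ℕ} {x y : R} (h : w ^ k * x = m ^ k * y) : m ^ k ∣ x :=
    hmw.pow.dvd_of_dvd_mul_left ⟨y, h⟩
  obtain ⟨S, rfl⟩ := (exists_eq_smul_iff hm).mpr
    ⟨hdvd (congrArg c₄ h), hdvd (congrArg c₆ h), hdvd (congrArg Δ h)⟩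
  exact ⟨S, rfl, smul_right_injective hm (by simpa only [smul_smul, mul_comm] using h.symm)⟩

theorem ext_of_c₄_of_c₆ (h : (1728 : R) ≠ 0) {T T' : Invariants R} (h₄ : T.c₄ = T'.c₄)
    (h₆ : T.c₆ = T'.c₆) : T = T' :=
  Invariants.ext h₄ h₆ (mul_left_cancel₀ h (by rw [T.relation, T'.relation, h₄, h₆]))

end Invariants

open Invariants

theorem ofCurve_twist (E : WeierstrassCurve ℚ) (d : ℤ) :
    ofCurve (twist E d) = (d : ℚ) • ofCurve E := by
  ext <;> simp only [twist, ofCurve_c₄, ofCurve_c₆, ofCurve_Δ, smul_c₄, smul_c₆, smul_Δ,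
    WeierstrassCurve.c₄, WeierstrassCurve.c₆, WeierstrassCurve.Δ, WeierstrassCurve.b₂,
    WeierstrassCurve.b₄, WeierstrassCurve.b₆, WeierstrassCurve.b₈] <;> ring

/-- The equation obtained from `W` by the substitution `(x, y) = (x' / n², y' / n³)`, which makes
sense, and preserves integrality, for every `n` in the base ring. -/
@[simps]
def scale {R : Type*} [CommRing R] (n : R) (W : WeierstrassCurve R) : WeierstrassCurve R where
  a₁ := n * W.a₁
  a₂ := n ^ 2 * W.a₂
  a₃ := n ^ 3 * W.a₃
  a₄ := n ^ 4 * W.a₄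
  a₆ := n ^ 6 * W.a₆

theorem ofCurve_scale {R : Type*} [CommRing R] (n : R) (W : WeierstrassCurve R) :
    ofCurve (scale n W) = n ^ 2 • ofCurve W := by
  ext <;> simp only [scale, ofCurve_c₄, ofCurve_c₆, ofCurve_Δ, smul_c₄, smul_c₆, smul_Δ,
    WeierstrassCurve.c₄, WeierstrassCurve.c₆, WeierstrassCurve.Δ, WeierstrassCurve.b₂,
    WeierstrassCurve.b₄, WeierstrassCurve.b₆, WeierstrassCurve.b₈] <;> ring

theorem curve_ext {R : Type*} [CommRing R] [IsDomain R] (h2 : (2 : R) ≠ 0) (h3 : (3 : R) ≠ 0)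
    {W W' : WeierstrassCurve R} (h₁ : W.a₁ = W'.a₁) (h₂ : W.a₂ = W'.a₂) (h₃ : W.a₃ = W'.a₃)
    (h : ofCurve W = ofCurve W') : W = W' := by
  have hb₂ : W.b₂ = W'.b₂ := by rw [WeierstrassCurve.b₂, WeierstrassCurve.b₂, h₁, h₂]
  have h24 : (24 : R) ≠ 0 := by
    rw [show (24 : R) = 2 ^ 3 * 3 by norm_num]; exact mul_ne_zero (pow_ne_zero 3 h2) h3
  have hb₄ : W.b₄ = W'.b₄ := by
    have hc₄ : W.c₄ = W'.c₄ := congrArg c₄ h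
    rw [WeierstrassCurve.c₄, WeierstrassCurve.c₄, hb₂] at hc₄
    exact mul_left_cancel₀ h24 (by linear_combination -hc₄)
  have hb₆ : W.b₆ = W'.b₆ := by
    have hc₆ : W.c₆ = W'.c₆ := congrArg c₆ h
    rw [WeierstrassCurve.c₆, WeierstrassCurve.c₆, hb₂, hb₄] at hc₆
    exact mul_left_cancel₀ (mul_ne_zero h24 (pow_ne_zero 2 h3)) (by linear_combination -hc₆)
  refine WeierstrassCurve.ext h₁ h₂ h₃ (mul_left_cancel₀ h2 ?_)
    (mul_left_cancel₀ (pow_ne_zero 2 h2) ?_)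
  · rw [WeierstrassCurve.b₄, WeierstrassCurve.b₄, h₁, h₃] at hb₄
    linear_combination hb₄
  · rw [WeierstrassCurve.b₆, WeierstrassCurve.b₆, h₃] at hb₆
    linear_combination hb₆

theorem exists_variableChange {K : Type*} [Field K] (h2 : (2 : K) ≠ 0) (h3 : (3 : K) ≠ 0)
    {W W' : WeierstrassCurve K} (u : Kˣ) (h : ofCurve W = (u : K) ^ 2 • ofCurve W') :
    ∃ r s t : K, (⟨u, r, s, t⟩ : WeierstrassCurve.VariableChange K) • W = W' := by
  have hu : (u : K) ≠ 0 := u.ne_zero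
  let s := (u * W'.a₁ - W.a₁) / 2
  let r := (u ^ 2 * W'.a₂ - W.a₂ + s * W.a₁ + s ^ 2) / 3
  let t := (u ^ 3 * W'.a₃ - W.a₃ - r * W.a₁) / 2
  refine ⟨r, s, t, curve_ext h2 h3 ?_ ?_ ?_ (smul_right_injective (pow_ne_zero 2 hu)
    ((ofCurve_eq_smul_variableChange ⟨u, r, s, t⟩ W).symm.trans h))⟩
  · simp only [WeierstrassCurve.variableChange_a₁, Units.val_inv_eq_inv_val, s]
    field_simp; ring
  · simp only [WeierstrassCurve.variableChange_a₂, Units.val_inv_eq_inv_val, r]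
    field_simp; ring
  · simp only [WeierstrassCurve.variableChange_a₃, Units.val_inv_eq_inv_val, t]
    field_simp; ring

/-- Kraus's condition at `2`, which the invariants of an integral equation satisfy. -/
def KrausTwo (T : Invariants ℤ) : Prop :=
  T.c₆ % 4 = 3 ∨ 16 ∣ T.c₄ ∧ (T.c₆ % 32 = 0 ∨ T.c₆ % 32 = 8)

/-- Kraus's condition at `3`, which the invariants of an integral equation satisfy; that
`v₃(c₆) ≠ 2` is expressed without valuations. -/
def KrausThree (T : Invariants ℤ) : Prop :=
  9 ∣ T.c₆ → 27 ∣ T.c₆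

/-- Kraus's condition at the prime `p`: there is none besides the integrality of `c₄`, `c₆`, `Δ`
unless `p` is `2` or `3`. -/
def KrausAt (p : ℕ) (T : Invariants ℤ) : Prop :=
  (p = 2 → KrausTwo T) ∧ (p = 3 → KrausThree T)

theorem krausAt_two_iff {T : Invariants ℤ} : KrausAt 2 T ↔ KrausTwo T :=
  ⟨fun h => h.1 rfl, fun h => ⟨fun _ => h, fun h3 => absurd h3 (by decide)⟩⟩

theorem krausTwo_ofCurve (V : WeierstrassCurve ℤ) : KrausTwo (ofCurve V) := by
  rw [KrausTwo, ofCurve_c₄, ofCurve_c₆, WeierstrassCurve.c₄, WeierstrassCurve.c₆]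
  rcases Int.even_or_odd' V.a₁ with ⟨n, ha₁ | ha₁⟩
  · obtain ⟨β, hβ⟩ : ∃ β, V.b₂ = 4 * β :=
      ⟨n ^ 2 + V.a₂, by rw [WeierstrassCurve.b₂, ha₁]; ring⟩
    obtain ⟨γ, hγ⟩ : ∃ γ, V.b₄ = 2 * γ :=
      ⟨V.a₄ + n * V.a₃, by rw [WeierstrassCurve.b₄, ha₁]; ring⟩
    have hb₆ : V.b₆ % 4 = 0 ∨ V.b₆ % 4 = 1 := by
      rw [WeierstrassCurve.b₆]
      rcases Int.even_or_odd' V.a₃ with ⟨m, ha₃ | ha₃⟩ <;> rw [ha₃] <;> ring_nf <;> omega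
    refine Or.inr ⟨⟨β ^ 2 - 3 * γ, by rw [hβ, hγ]; ring⟩, ?_⟩
    have hc₆ : -V.b₂ ^ 3 + 36 * V.b₂ * V.b₄ - 216 * V.b₆ =
        32 * (-2 * β ^ 3 + 9 * β * γ - 7 * V.b₆) + 8 * V.b₆ := by rw [hβ, hγ]; ring
    omega
  · obtain ⟨β, hβ⟩ : ∃ β, V.b₂ = 4 * β + 1 :=
      ⟨n ^ 2 + n + V.a₂, by rw [WeierstrassCurve.b₂, ha₁]; ring⟩
    have hc₆ : -V.b₂ ^ 3 + 36 * V.b₂ * V.b₄ - 216 * V.b₆ = 4 * (-16 * β ^ 3 - 12 * β ^ 2 -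
        3 * β + 9 * (4 * β + 1) * V.b₄ - 54 * V.b₆) - 1 := by rw [hβ]; ring
    omega

theorem krausThree_ofCurve (V : WeierstrassCurve ℤ) : KrausThree (ofCurve V) := by
  intro (h : 9 ∣ V.c₆)
  obtain ⟨m, hm⟩ : 3 ∣ V.b₂ := by
    refine Int.prime_three.dvd_of_dvd_pow (n := 3) ?_
    have hb₂ : V.b₂ ^ 3 = 3 * (12 * V.b₂ * V.b₄ - 72 * V.b₆) - V.c₆ := by
      rw [WeierstrassCurve.c₆]; ring
    rw [hb₂]
    exact dvd_sub (dvd_mul_right _ _) (Dvd.dvd.trans (by norm_num) h)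
  refine ⟨-m ^ 3 + 4 * m * V.b₄ - 8 * V.b₆, ?_⟩
  rw [ofCurve_c₆, WeierstrassCurve.c₆, hm]
  ring

theorem krausAt_ofCurve (p : ℕ) (V : WeierstrassCurve ℤ) : KrausAt p (ofCurve V) :=
  ⟨fun _ => krausTwo_ofCurve V, fun _ => krausThree_ofCurve V⟩

/- Every integral equation has `b₂ ≡ -c₆ mod 12`, and a translation of `x` changes `b₂` by an
arbitrary multiple of `12`; so one may look for equations with `b₂ = -c₆`. -/
theorem ofCurve_eq_of_b {T : Invariants ℤ} {V : WeierstrassCurve ℤ} (h₂ : V.b₂ = -T.c₆)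
    (h₄ : 24 * V.b₄ = T.c₆ ^ 2 - T.c₄)
    (h₆ : 432 * V.b₆ = -(T.c₆ * (T.c₆ ^ 2 - 3 * T.c₄ + 2))) : ofCurve V = T := by
  refine ext_of_c₄_of_c₆ (by norm_num) ?_ (mul_left_cancel₀ (two_ne_zero (α := ℤ)) ?_)
  · rw [ofCurve_c₄, WeierstrassCurve.c₄, h₂]
    linear_combination -h₄
  · rw [ofCurve_c₆, WeierstrassCurve.c₆, h₂]
    linear_combination (-3 * T.c₆) * h₄ - h₆

theorem three_dvd_c₆_sq_sub_c₄ (T : Invariants ℤ) : 3 ∣ T.c₆ ^ 2 - T.c₄ := by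
  obtain ⟨q, hq⟩ := Int.prime_dvd_pow_self_sub Nat.prime_three T.c₄
  exact ⟨q - 576 * T.Δ, by linear_combination hq + T.relation⟩

theorem KrausThree.dvd_c₆_mul {T : Invariants ℤ} (h : KrausThree T) :
    27 ∣ T.c₆ * (T.c₆ ^ 2 - 3 * T.c₄ + 2) := by
  have hrel := T.relation
  obtain ⟨q, hq⟩ := three_dvd_c₆_sq_sub_c₄ T
  by_cases h3 : 3 ∣ T.c₆
  · obtain ⟨a, ha⟩ : 3 ∣ T.c₄ := by
      obtain ⟨b, hb⟩ := h3
      exact ⟨3 * b ^ 2 - q, by rw [hb] at hq; linarith⟩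
    obtain ⟨b, hb⟩ := h3
    obtain ⟨c, rfl⟩ : 3 ∣ b := Int.prime_three.dvd_of_dvd_pow (n := 2)
      ⟨a ^ 3 - 64 * T.Δ, by rw [ha, hb] at hrel; linarith⟩
    exact (h ⟨c, by rw [hb]; ring⟩).mul_right _
  · obtain ⟨i, hi⟩ : ∃ i, T.c₄ = 3 * i + 1 := by
      obtain ⟨b, hb⟩ : ∃ b, T.c₆ ^ 2 = 3 * b + 1 := by
        obtain ⟨b, hb | hb⟩ : ∃ b, T.c₆ = 3 * b + 1 ∨ T.c₆ = 3 * b - 1 :=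
          ⟨(T.c₆ + 1) / 3, by omega⟩
        · exact ⟨3 * b ^ 2 + 2 * b, by rw [hb]; ring⟩
        · exact ⟨3 * b ^ 2 - 2 * b, by rw [hb]; ring⟩
      exact ⟨b - q, by linarith⟩
    refine Dvd.dvd.mul_left ⟨i ^ 2 * (i + 1) - 64 * T.Δ, ?_⟩ _
    rw [hi] at hrel ⊢
    linear_combination hrel

theorem odd_c₄_of_odd_c₆ {T : Invariants ℤ} (h : ¬ 2 ∣ T.c₆) : ¬ 2 ∣ T.c₄ := by
  rintro ⟨a, ha⟩
  have hrel := T.relation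
  obtain ⟨b, hb⟩ : ∃ b, T.c₆ = 2 * b + 1 := ⟨T.c₆ / 2, by omega⟩
  rw [ha, hb] at hrel
  ring_nf at hrel
  omega

theorem exists_ofCurve_eq_of_c₆_odd {T : Invariants ℤ} (h : T.c₆ % 4 = 3) (h3 : KrausThree T) :
    ∃ V : WeierstrassCurve ℤ, ofCurve V = T := by
  have hrel := T.relation
  obtain ⟨i, hi⟩ : ∃ i, T.c₄ = 8 * i + 1 := by
    have hodd : ¬ 2 ∣ T.c₄ := odd_c₄_of_odd_c₆ (by omega)
    obtain ⟨b, hb⟩ : ∃ b, T.c₆ = 4 * b + 3 := ⟨T.c₆ / 4, by omega⟩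
    obtain ⟨a, ha⟩ : ∃ a, T.c₄ = 2 * a + 1 := ⟨T.c₄ / 2, by omega⟩
    obtain ⟨q, hq⟩ := Int.even_mul_succ_self a
    rw [ha, hb] at hrel
    exact ⟨216 * T.Δ + 2 * b ^ 2 + 3 * b + 1 - (a ^ 3 + a ^ 2 + q), by linarith⟩
  obtain ⟨j, hj⟩ : ∃ j, T.c₆ ^ 2 - T.c₄ = 16 * j :=
    ⟨i * (8 * i + 1) * (4 * i + 1) - 108 * T.Δ, by rw [hi] at hrel ⊢; linear_combination hrel⟩
  obtain ⟨l, hl⟩ : ∃ l, T.c₆ * (T.c₆ ^ 2 - 3 * T.c₄ + 2) = 64 * l :=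
    ⟨T.c₆ * (i ^ 2 * (8 * i + 3) - 27 * T.Δ), by
      rw [hi] at hrel ⊢; linear_combination T.c₆ * hrel⟩
  have hdvd₄ := three_dvd_c₆_sq_sub_c₄ T
  have hdvd₆ := h3.dvd_c₆_mul
  refine ⟨⟨1, (-T.c₆ - 1) / 4, 0, j / 3, -l / 27⟩, ofCurve_eq_of_b ?_ ?_ ?_⟩ <;>
  simp only [WeierstrassCurve.b₂, WeierstrassCurve.b₄, WeierstrassCurve.b₆] <;> omega

theorem exists_ofCurve_eq_of_c₆_even {T : Invariants ℤ} (h₄ : 16 ∣ T.c₄)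
    (h₆ : T.c₆ % 32 = 0 ∨ T.c₆ % 32 = 8) (h3 : KrausThree T) :
    ∃ V : WeierstrassCurve ℤ, ofCurve V = T := by
  obtain ⟨i, hi⟩ := h₄
  obtain ⟨b, hb⟩ : 8 ∣ T.c₆ := by omega
  obtain ⟨j, hj⟩ : ∃ j, T.c₆ ^ 2 - T.c₄ = 16 * j :=
    ⟨4 * b ^ 2 - i, by rw [hi, hb]; ring⟩
  obtain ⟨l, hl⟩ : ∃ l, T.c₆ * (T.c₆ ^ 2 - 3 * T.c₄ + 2) = 16 * (4 * l + b) :=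
    ⟨b * (8 * b ^ 2 - 6 * i), by rw [hi, hb]; ring⟩
  have hdvd₄ := three_dvd_c₆_sq_sub_c₄ T
  have hdvd₆ := h3.dvd_c₆_mul
  obtain hb0 | hb1 : b % 4 = 0 ∨ b % 4 = 1 := by omega
  · refine ⟨⟨0, -2 * b, 0, j / 3, -(4 * l + b) / 108⟩, ofCurve_eq_of_b ?_ ?_ ?_⟩ <;>
    simp only [WeierstrassCurve.b₂, WeierstrassCurve.b₄, WeierstrassCurve.b₆] <;> omega
  · refine ⟨⟨0, -2 * b, 1, j / 3, (-(4 * l + b) - 27) / 108⟩, ofCurve_eq_of_b ?_ ?_ ?_⟩ <;>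
    simp only [WeierstrassCurve.b₂, WeierstrassCurve.b₄, WeierstrassCurve.b₆] <;> omega

theorem exists_ofCurve_eq {T : Invariants ℤ} (h : ∀ (p : ℕ) [Fact p.Prime], KrausAt p T) :
    ∃ V : WeierstrassCurve ℤ, ofCurve V = T := by
  have h3 : KrausThree T := (h 3).2 rfl
  obtain h₆ | ⟨h₄, h₆⟩ := (h 2).1 rfl
  · exact exists_ofCurve_eq_of_c₆_odd h₆ h3
  · exact exists_ofCurve_eq_of_c₆_even h₄ h₆ h3

/-- For square-free `w` this says that `ℚ(√w)` is unramified at `p`; twisting by such `w` preserves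
all conditions at `p`. -/
def UnramifiedAt (p : ℕ) (w : ℤ) : Prop :=
  ¬ (p : ℤ) ∣ w ∧ (p = 2 → w % 4 = 1)

theorem krausAt_smul_of_dvd {p : ℕ} {v : ℤ} (hv : (p : ℤ) ∣ v) (hv2 : p = 2 → 4 ∣ v)
    (T : Invariants ℤ) :
    KrausAt p (v • T) := by
  constructor
  · rintro rfl
    obtain ⟨q, rfl⟩ := hv2 rfl
    refine Or.inr ⟨⟨q ^ 2 * T.c₄, ?_⟩, Or.inl (Int.emod_eq_zero_of_dvd ⟨2 * q ^ 3 * T.c₆, ?_⟩)⟩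
    · rw [smul_c₄]; ring
    · rw [smul_c₆]; ring
  · rintro rfl _
    obtain ⟨q, rfl⟩ := hv
    exact ⟨q ^ 3 * T.c₆, by rw [smul_c₆]; push_cast; ring⟩

/-- The triples of invariants of integral equations that are minimal at `p`: they satisfy Kraus's
condition, but cease to do so when divided by `(p⁴, p⁶, p¹²)`. -/
def IsMinimalAt (p : ℕ) (T : Invariants ℤ) : Prop :=
  KrausAt p T ∧ ∀ T' : Invariants ℤ, T = (p : ℤ) ^ 2 • T' → ¬ KrausAt p T'

theorem two_pow_dvd_mul_iff {w : ℤ} (hw : ¬ 2 ∣ w) (k : ℕ) {x : ℤ} :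
    2 ^ k ∣ w * x ↔ 2 ^ k ∣ x :=
  ⟨(Int.prime_two.coprime_iff_not_dvd.mpr hw).pow_left.dvd_of_dvd_mul_left, (·.mul_left w)⟩

theorem krausTwo_smul_iff_of_odd {w : ℤ} (hw : ¬ 2 ∣ w) {T : Invariants ℤ} :
    KrausTwo (w • T) ↔ T.c₆ * w % 4 = 3 ∨
      16 ∣ T.c₄ ∧ 8 ∣ T.c₆ ∧ (T.c₆ / 8 * w % 4 = 0 ∨ T.c₆ / 8 * w % 4 = 1) := by
  have h₄ : 16 ∣ w ^ 2 * T.c₄ ↔ 16 ∣ T.c₄ := by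
    rw [sq, mul_assoc]
    exact (two_pow_dvd_mul_iff hw 4).trans (two_pow_dvd_mul_iff hw 4)
  obtain ⟨q, hq⟩ : (8 : ℤ) ∣ w ^ 2 - 1 := Int.eight_dvd_sq_sub_one_of_odd (by grind)
  have h₆ (x : ℤ) : w ^ 3 * x = 8 * (q * (x * w)) + x * w := by linear_combination x * w * hq
  rw [KrausTwo, smul_c₄, smul_c₆, h₄]
  refine or_congr (by have := h₆ T.c₆; omega) (and_congr_right fun _ => ?_)
  by_cases h8 : 8 ∣ T.c₆
  · obtain ⟨x, hx⟩ := h8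
    have hx8 : T.c₆ / 8 = x := by omega
    rw [hx8, hx, mul_left_comm, h₆]
    omega
  · have : 8 ∣ T.c₆ * w ↔ 8 ∣ T.c₆ := by rw [mul_comm]; exact two_pow_dvd_mul_iff hw 3
    have := h₆ T.c₆
    omega

theorem krausTwo_smul_iff {w : ℤ} (hw : w % 4 = 1) {T : Invariants ℤ} :
    KrausTwo (w • T) ↔ KrausTwo T := by
  rw [krausTwo_smul_iff_of_odd (by omega), KrausTwo]
  obtain ⟨q, rfl⟩ : ∃ q, w = 4 * q + 1 := ⟨w / 4, by omega⟩
  have hq (x : ℤ) : x * (4 * q + 1) = 4 * (x * q) + x := by ring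
  rw [hq, hq]
  omega

theorem krausThree_smul_iff {w : ℤ} (hw : ¬ 3 ∣ w) {T : Invariants ℤ} :
    KrausThree (w • T) ↔ KrausThree T := by
  have hw3 : IsCoprime (3 : ℤ) w := Int.prime_three.coprime_iff_not_dvd.mpr hw
  have hw9 : IsCoprime (9 : ℤ) (w ^ 3) := by simpa using hw3.pow (m := 2) (n := 3)
  have hw27 : IsCoprime (27 : ℤ) (w ^ 3) := by simpa using hw3.pow (m := 3) (n := 3)
  exact imp_congr ⟨hw9.dvd_of_dvd_mul_left, (·.mul_left _)⟩
    ⟨hw27.dvd_of_dvd_mul_left, (·.mul_left _)⟩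

theorem krausAt_smul_iff {p : ℕ} {w : ℤ} (hw : UnramifiedAt p w) {T : Invariants ℤ} :
    KrausAt p (w • T) ↔ KrausAt p T := by
  refine and_congr (imp_congr_right ?_) (imp_congr_right ?_)
  · rintro rfl
    exact krausTwo_smul_iff (hw.2 rfl)
  · rintro rfl
    exact krausThree_smul_iff hw.1

section Local

variable {p : ℕ} [hp : Fact p.Prime]

theorem UnramifiedAt.isCoprime {w : ℤ} (hw : UnramifiedAt p w) : IsCoprime (p : ℤ) w :=
  (Nat.prime_iff_prime_int.mp hp.out).coprime_iff_not_dvd.mpr hw.1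

theorem unramifiedAt_sq {m : ℤ} (hm : ¬ (p : ℤ) ∣ m) : UnramifiedAt p (m ^ 2) := by
  refine ⟨mt (Nat.prime_iff_prime_int.mp hp.out).dvd_of_dvd_pow hm, ?_⟩
  rintro rfl
  exact Int.sq_mod_four_eq_one_of_odd (Int.not_even_iff_odd.mp (mt Even.two_dvd hm))

theorem isMinimalAt_smul_iff {w : ℤ} (hw : UnramifiedAt p w) {T : Invariants ℤ} :
    IsMinimalAt p (w • T) ↔ IsMinimalAt p T := by
  have hp0 : (p : ℤ) ^ 2 ≠ 0 := pow_ne_zero 2 (Nat.cast_ne_zero.mpr hp.out.ne_zero)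
  refine and_congr (krausAt_smul_iff hw) ⟨fun h T' hT' hk => ?_, fun h T' hT' hk => ?_⟩
  · refine h (w • T') ?_ ((krausAt_smul_iff hw).mpr hk)
    rw [hT', smul_comm]
  · obtain ⟨S, hS, rfl⟩ := exists_smul_eq_of_isCoprime hp0 hw.isCoprime.pow_left hT'
    exact h S hS ((krausAt_smul_iff hw).mp hk)

theorem isMinimalAt_sq_smul_iff {m : ℤ} (hm : ¬ (p : ℤ) ∣ m) {T : Invariants ℤ} :
    IsMinimalAt p (m ^ 2 • T) ↔ IsMinimalAt p T :=
  isMinimalAt_smul_iff (unramifiedAt_sq hm)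

theorem isMinimalAt_prime_sq_smul {T : Invariants ℤ} (hT : ¬ KrausAt p T) :
    IsMinimalAt p ((p : ℤ) ^ 2 • T) := by
  refine ⟨krausAt_smul_of_dvd (dvd_pow_self _ two_ne_zero) ?_ T, fun T' hT' => ?_⟩
  · rintro rfl
    norm_num
  · have hp0 : (p : ℤ) ^ 2 ≠ 0 := pow_ne_zero 2 (Nat.cast_ne_zero.mpr hp.out.ne_zero)
    rwa [← smul_right_injective hp0 hT']

end Local

theorem isMinimal_iff_forall_isInteger {R K : Type*} [CommRing R] [IsDomain R]
    [IsDiscreteValuationRing R] [Field K] [Algebra R K] [IsFractionRing R K]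
    {W : WeierstrassCurve K} (hΔ : W.Δ ≠ 0) :
    W.IsMinimal R ↔ W.IsIntegral R ∧ ∀ C : WeierstrassCurve.VariableChange K,
      (C • W).IsIntegral R → IsLocalization.IsInteger R (C.u : K)⁻¹ := by
  let v := (IsDiscreteValuationRing.maximalIdeal R).valuation K
  have hv (x : K) : IsLocalization.IsInteger R x ↔ v x ≤ 1 :=
    ⟨fun ⟨r, hr⟩ => hr ▸ IsDedekindDomain.HeightOneSpectrum.valuation_le_one _ r,
      IsDiscreteValuationRing.exists_lift_of_le_one⟩
  have hv0 : 0 < v W.Δ := zero_lt_iff.mpr ((v.ne_zero_iff).mpr hΔ)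
  have hle (C : WeierstrassCurve.VariableChange K) (hW : W.IsIntegral R)
      (hC : (C • W).IsIntegral R) :
      (C • W).valuation_Δ_aux R ≤ W.valuation_Δ_aux R ↔
        IsLocalization.IsInteger R (C.u : K)⁻¹ := by
    rw [hv, ← Subtype.coe_le_coe, WeierstrassCurve.valuation_Δ_aux_eq_of_isIntegral,
      WeierstrassCurve.valuation_Δ_aux_eq_of_isIntegral, WeierstrassCurve.variableChange_Δ,
      Units.val_inv_eq_inv_val, map_mul, map_pow]
    rw [mul_le_iff_le_one_left hv0, pow_le_one_iff (by norm_num)]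
  simp only [WeierstrassCurve.isMinimal_iff, MaximalFor, one_smul]
  refine and_congr_right fun hW => forall_congr' fun C => forall_congr' fun hC => ?_
  rw [← hle C hW hC]
  exact ⟨fun h => (le_total _ _).elim h id, fun h _ => h⟩

section Local

variable {p : ℕ} [hp : Fact p.Prime]

theorem isInteger_padic_iff {x : ℚ} :
    IsLocalization.IsInteger (Rat.padicValuation p).valuationSubring x ↔ ¬ p ∣ x.den := by
  rw [← Rat.padicValuation_le_one_iff]
  exact ⟨fun ⟨y, hy⟩ => hy ▸ y.2, fun h => ⟨⟨x, h⟩, rfl⟩⟩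

theorem isIntegral_padic_map (V : WeierstrassCurve ℤ) :
    (V.map (Int.castRingHom ℚ)).IsIntegral (Rat.padicValuation p).valuationSubring :=
  ⟨V.map (Int.castRingHom _), by
    rw [WeierstrassCurve.baseChange, WeierstrassCurve.map_map]; congr 1⟩

theorem exists_map_eq_scale {W : WeierstrassCurve ℚ}
    (h : W.IsIntegral (Rat.padicValuation p).valuationSubring) :
    ∃ m : ℤ, ¬ (p : ℤ) ∣ m ∧
      ∃ V : WeierstrassCurve ℤ, V.map (Int.castRingHom ℚ) = scale (m : ℚ) W := by
  let dens : List ℕ := [W.a₁.den, W.a₂.den, W.a₃.den, W.a₄.den, W.a₆.den]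
  have hden {x : ℚ} (hx : x.den ∈ dens) (k : ℕ) :
      ∃ z : ℤ, (z : ℚ) = (dens.prod : ℤ) ^ (k + 1) * x := by
    obtain ⟨q, hq⟩ := List.dvd_prod hx
    refine ⟨(dens.prod : ℤ) ^ k * q * x.num, ?_⟩
    rw [pow_succ, hq]
    push_cast
    linear_combination -((x.den * q : ℚ) ^ k * q) * Rat.mul_den_eq_num x
  obtain ⟨z₁, h₁⟩ := hden (x := W.a₁) (by simp [dens]) 0
  obtain ⟨z₂, h₂⟩ := hden (x := W.a₂) (by simp [dens]) 1
  obtain ⟨z₃, h₃⟩ := hden (x := W.a₃) (by simp [dens]) 2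
  obtain ⟨z₄, h₄⟩ := hden (x := W.a₄) (by simp [dens]) 3
  obtain ⟨z₆, h₆⟩ := hden (x := W.a₆) (by simp [dens]) 5
  refine ⟨dens.prod, ?_, ⟨z₁, z₂, z₃, z₄, z₆⟩, ?_⟩
  · obtain ⟨V, rfl⟩ := h
    rw [Int.natCast_dvd_natCast, hp.out.prime.dvd_prod_iff]
    have hV (x : (Rat.padicValuation p).valuationSubring) : ¬ p ∣ (x : ℚ).den :=
      isInteger_padic_iff.mp ⟨x, rfl⟩
    simp [dens, hV]
  · ext <;> simp [h₁, h₂, h₃, h₄, h₆]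

theorem isInteger_inv_of_isMinimalAt {V : WeierstrassCurve ℤ} (h : IsMinimalAt p (ofCurve V))
    {C : WeierstrassCurve.VariableChange ℚ}
    (hC : (C • V.map (Int.castRingHom ℚ)).IsIntegral (Rat.padicValuation p).valuationSubring) :
    IsLocalization.IsInteger (Rat.padicValuation p).valuationSubring (C.u : ℚ)⁻¹ := by
  rw [isInteger_padic_iff]
  rintro ⟨n, hn⟩
  obtain ⟨m, hm, V', hV'⟩ := exists_map_eq_scale hC
  let x : ℚ := (C.u : ℚ)⁻¹
  have hnum : ¬ (p : ℤ) ∣ x.num := fun hdvd => hp.out.not_dvd_one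
    (x.reduced ▸ Nat.dvd_gcd (Int.natCast_dvd.mp hdvd) ⟨n, hn⟩)
  have hx : (x.num : ℚ) = x * (p * n) := by
    rw [← Nat.cast_mul, ← hn, Rat.mul_den_eq_num]
  have hxu : x * C.u = 1 := inv_mul_cancel₀ C.u.ne_zero
  have hT : (m * x.num) ^ 2 • ofCurve V = (p : ℤ) ^ 2 • ofCurve (scale (n : ℤ) V') := by
    refine map_injective (RingHom.injective_int (Int.castRingHom ℚ)) ?_
    rw [Invariants.map_smul, Invariants.map_smul, ofCurve_scale, Invariants.map_smul,
      ← ofCurve_map, ← ofCurve_map, hV', ofCurve_scale, ofCurve_eq_smul_variableChange C,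
      smul_smul, smul_smul, smul_smul]
    congr 1
    simp only [eq_intCast]
    push_cast
    rw [hx]
    linear_combination (m * p * n : ℚ) ^ 2 * (x * C.u + 1) * hxu
  have hmin := (isMinimalAt_sq_smul_iff
    (mt (Nat.prime_iff_prime_int.mp hp.out).dvd_or_dvd (not_or.mpr ⟨hm, hnum⟩))).mpr h
  exact hmin.2 _ hT (krausAt_ofCurve p _)

theorem exists_ofCurve_eq_of_eq_smul {V : WeierstrassCurve ℤ} {T : Invariants ℤ}
    (hV : ofCurve V = (p : ℤ) ^ 2 • T) (hT : KrausAt p T) :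
    ∃ V' : WeierstrassCurve ℤ, ofCurve V' = T := by
  refine exists_ofCurve_eq fun q hq => ?_
  by_cases hqp : q = p
  · exact hqp ▸ hT
  · have hqp' : ¬ (q : ℤ) ∣ p := by
      rwa [Int.natCast_dvd_natCast, Nat.prime_dvd_prime_iff_eq hq.out hp.out]
    rw [← krausAt_smul_iff (unramifiedAt_sq hqp'), ← hV]
    exact krausAt_ofCurve q V

theorem isMinimal_map_iff {V : WeierstrassCurve ℤ} (hΔ : V.Δ ≠ 0) :
    (V.map (Int.castRingHom ℚ)).IsMinimal (Rat.padicValuation p).valuationSubring ↔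
      IsMinimalAt p (ofCurve V) := by
  rw [isMinimal_iff_forall_isInteger (by simpa using hΔ)]
  refine ⟨fun ⟨_, h⟩ => ⟨krausAt_ofCurve p V, fun T hT hk => ?_⟩,
    fun h => ⟨isIntegral_padic_map V, fun _ hC => isInteger_inv_of_isMinimalAt h hC⟩⟩
  obtain ⟨V', rfl⟩ := exists_ofCurve_eq_of_eq_smul hT hk
  obtain ⟨r, s, t, hC⟩ := exists_variableChange two_ne_zero three_ne_zero
    (W := V.map (Int.castRingHom ℚ)) (W' := V'.map (Int.castRingHom ℚ))
    (Units.mk0 (p : ℚ) (Nat.cast_ne_zero.mpr hp.out.ne_zero))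
    (by rw [ofCurve_map, hT, Invariants.map_smul, ofCurve_map]; simp)
  have hinv := h _ (hC ▸ isIntegral_padic_map V')
  rw [isInteger_padic_iff, Units.val_mk0, Rat.inv_natCast_den_of_pos hp.out.pos] at hinv
  exact hinv dvd_rfl

end Local

theorem isGlobalMinimal_map_iff {V : WeierstrassCurve ℤ} (hΔ : V.Δ ≠ 0) :
    IsGlobalMinimal (V.map (Int.castRingHom ℚ)) ↔
      ∀ (p : ℕ) [Fact p.Prime], IsMinimalAt p (ofCurve V) :=
  ⟨fun h p _ => (isMinimal_map_iff hΔ).mp (h.2 p),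
    fun h => ⟨⟨V, rfl⟩, fun p _ => (isMinimal_map_iff hΔ).mpr (h p)⟩⟩

theorem natCast_le_vp_iff {p : ℕ} [Fact p.Prime] (n : ℕ) (A : ℤ) :
    ((n : ℤ) : WithTop ℤ) ≤ vp p (A : ℚ) ↔ (p : ℤ) ^ n ∣ A := by
  rw [padicValInt_dvd_iff, vp]
  split_ifs with h
  · simpa using Or.inl (by exact_mod_cast h)
  · have h' : A ≠ 0 := by exact_mod_cast h
    rw [padicValRat.of_int, WithTop.coe_le_coe, Nat.cast_le]
    simp [h']

theorem vp_eq_natCast_iff {p : ℕ} [Fact p.Prime] (n : ℕ) (A : ℤ) :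
    vp p (A : ℚ) = ((n : ℤ) : WithTop ℤ) ↔ (p : ℤ) ^ n ∣ A ∧ ¬ (p : ℤ) ^ (n + 1) ∣ A := by
  rw [← natCast_le_vp_iff, ← natCast_le_vp_iff]
  cases vp p (A : ℚ) with
  | top => simp
  | coe y => norm_cast; push_cast; omega

theorem ofNat_le_vp_iff {p : ℕ} [Fact p.Prime] (n : ℕ) [n.AtLeastTwo] (A : ℤ) :
    ofNat(n) ≤ vp p (A : ℚ) ↔ (p : ℤ) ^ (ofNat(n) : ℕ) ∣ A :=
  natCast_le_vp_iff n A

theorem vp_eq_ofNat_iff {p : ℕ} [Fact p.Prime] (n : ℕ) [n.AtLeastTwo] (A : ℤ) :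
    vp p (A : ℚ) = ofNat(n) ↔ (p : ℤ) ^ (ofNat(n) : ℕ) ∣ A ∧ ¬ (p : ℤ) ^ (ofNat(n) + 1) ∣ A :=
  vp_eq_natCast_iff n A

theorem zero_le_vp {p : ℕ} [Fact p.Prime] (A : ℤ) : 0 ≤ vp p (A : ℚ) :=
  (natCast_le_vp_iff 0 A).mpr (by simp)

theorem vp_eq_zero_iff {p : ℕ} [Fact p.Prime] (A : ℤ) : vp p (A : ℚ) = 0 ↔ ¬ (p : ℤ) ∣ A := by
  simpa using vp_eq_natCast_iff (p := p) 0 A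

theorem div_pow_mul_modEq_iff {b m : ℤ} {k : ℕ} (hm : 2 ^ k = m) (h : m ∣ b) (x y : ℤ) :
    (b : ℚ) / 2 ^ k * x ≡ y [PMOD (4 : ℚ)] ↔ b / m * x % 4 = y % 4 := by
  have hm0 : (m : ℚ) ≠ 0 := by rw [← hm]; simp
  have hmk : (m : ℚ) = 2 ^ k := by rw [← hm]; simp
  rw [← hmk, ← Int.cast_div h hm0, ← Int.cast_mul, show (4 : ℚ) = ((4 : ℤ) : ℚ) by norm_num,
    AddCommGroup.intCast_modEq_intCast, AddCommGroup.modEq_iff_intModEq, Int.ModEq]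

open Classical in
theorem twoFactorOfThreeModFour_map (V : WeierstrassCurve ℤ) (d : ℤ) :
    twoFactorOfThreeModFour (V.map (Int.castRingHom ℚ)) d =
      if ¬ 2 ∣ V.c₄ ∧ ¬ 2 ∣ V.c₆ ∨ 16 ∣ V.c₄ ∧ (8 ∣ V.c₆ ∧ ¬ 16 ∣ V.c₆) ∧ ¬ 2 ∣ V.Δ then 1 / 2
      else if
          4096 ∣ V.Δ ∧ (16 ∣ V.c₄ ∧ ¬ 32 ∣ V.c₄) ∧ (64 ∣ V.c₆ ∧ ¬ 128 ∣ V.c₆) ∧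
            V.c₆ / 64 * d % 4 = 3 ∨
          256 ∣ V.c₄ ∧ (512 ∣ V.c₆ ∧ ¬ 1024 ∣ V.c₆) ∧ (4096 ∣ V.Δ ∧ ¬ 8192 ∣ V.Δ) ∧
            V.c₆ / 512 * d % 4 = 1 then 2
      else 1 := by
  have hmod₆₄ (h : 64 ∣ V.c₆) := div_pow_mul_modEq_iff (k := 6) (by norm_num) h d (-1)
  have hmod₅₁₂ (h : 512 ∣ V.c₆) := div_pow_mul_modEq_iff (k := 9) (by norm_num) h d 1
  push_cast at hmod₆₄ hmod₅₁₂
  refine if_congr ?_ rfl (if_congr ?_ rfl rfl)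
  · simp [HasSignature, vp_eq_zero_iff, vp_eq_ofNat_iff, ofNat_le_vp_iff, zero_le_vp]
  · refine or_congr ?_ ?_
    · simp +contextual [HasSignature, vp_eq_ofNat_iff, ofNat_le_vp_iff, hmod₆₄, and_assoc]
    · simp +contextual [HasSignature, vp_eq_ofNat_iff, ofNat_le_vp_iff, hmod₅₁₂, and_assoc]

open Classical in
theorem twoFactorOfTwoModFour_map (V : WeierstrassCurve ℤ) (w : ℤ) :
    twoFactorOfTwoModFour (V.map (Int.castRingHom ℚ)) (2 * w) =
      if ¬ 2 ∣ V.c₄ ∧ ¬ 2 ∣ V.c₆ then 1 / 2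
      else if 262144 ∣ V.Δ ∧ (64 ∣ V.c₄ ∧ ¬ 128 ∣ V.c₄) ∧ (512 ∣ V.c₆ ∧ ¬ 1024 ∣ V.c₆) ∧
          V.c₆ / 512 * w % 4 = 3 then 4
      else if (16 ∣ V.c₄ ∧ ¬ 64 ∣ V.c₄) ∨
          (8 ∣ V.c₆ ∧ ¬ 16 ∣ V.c₆ ∨ 32 ∣ V.c₆ ∧ ¬ 64 ∣ V.c₆ ∨ 128 ∣ V.c₆ ∧ ¬ 256 ∣ V.c₆) ∨
          64 ∣ V.c₄ ∧ (64 ∣ V.c₆ ∧ ¬ 128 ∣ V.c₆) ∧ (64 ∣ V.Δ ∧ ¬ 128 ∣ V.Δ) ∧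
            V.c₆ / 64 * w % 4 = 3 then 1
      else 2 := by
  have hmod₆₄ (h : 64 ∣ V.c₆) := div_pow_mul_modEq_iff (k := 6) (by norm_num) h w (-1)
  have hmod₅₁₂ (h : 512 ∣ V.c₆) := div_pow_mul_modEq_iff (k := 9) (by norm_num) h w (-1)
  push_cast at hmod₆₄ hmod₅₁₂
  refine if_congr ?_ rfl (if_congr ?_ rfl (if_congr ?_ rfl rfl))
  · simp [HasSignature, vp_eq_zero_iff, zero_le_vp]
  · simp +contextual [HasSignature, vp_eq_ofNat_iff, ofNat_le_vp_iff, hmod₅₁₂, and_assoc]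
  · refine or_congr ?_ (or_congr ?_ ?_)
    · simp only [WeierstrassCurve.map_c₄, eq_intCast, vp_eq_ofNat_iff, Nat.cast_ofNat,
        Int.reducePow, Nat.reduceAdd]
      omega
    · simp [vp_eq_ofNat_iff]
    · simp +contextual [HasSignature, vp_eq_ofNat_iff, ofNat_le_vp_iff, hmod₆₄, and_assoc]

theorem not_two_dvd_Δ {T : Invariants ℤ} (h₄ : 16 ∣ T.c₄) (h₆ : 8 ∣ T.c₆) (h₆' : ¬ 16 ∣ T.c₆) :
    ¬ 2 ∣ T.Δ := by
  have h := T.relation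
  obtain ⟨a, ha⟩ := h₄
  obtain ⟨b, hb⟩ : ∃ b, T.c₆ = 8 * (2 * b + 1) := ⟨T.c₆ / 16, by omega⟩
  rw [ha, hb] at h
  have : 64 * a ^ 3 - 4 * b ^ 2 - 4 * b - 1 = 27 * T.Δ := by linarith
  omega

theorem sixtyFour_dvd_Δ {T : Invariants ℤ} (h₄ : 64 ∣ T.c₄) (h₆ : 64 ∣ T.c₆) : 64 ∣ T.Δ := by
  have h := T.relation
  obtain ⟨a, ha⟩ := h₄
  obtain ⟨b, hb⟩ := h₆
  rw [ha, hb] at h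
  have : 4096 * a ^ 3 - 64 * b ^ 2 = 27 * T.Δ := by linarith
  omega

theorem not_krausTwo_smul_iff_of_three_mod_four {T : Invariants ℤ} (hT : KrausTwo T) {d : ℤ}
    (hd : d % 4 = 3) :
    ¬ KrausTwo (d • T) ↔
      ¬ 2 ∣ T.c₄ ∧ ¬ 2 ∣ T.c₆ ∨ 16 ∣ T.c₄ ∧ (8 ∣ T.c₆ ∧ ¬ 16 ∣ T.c₆) ∧ ¬ 2 ∣ T.Δ := by
  rw [krausTwo_smul_iff_of_odd (by omega)]
  obtain ⟨q, rfl⟩ : ∃ q, d = 4 * q - 1 := ⟨d / 4 + 1, by omega⟩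
  have hq (x : ℤ) : x * (4 * q - 1) = 4 * (x * q) - x := by ring
  rw [hq, hq]
  have := @not_two_dvd_Δ T
  have := @odd_c₄_of_odd_c₆ T
  rw [KrausTwo] at hT
  omega

theorem exists_eq_four_smul_iff_of_three_mod_four {T : Invariants ℤ} (hT : IsMinimalAt 2 T)
    {d : ℤ} (hd : d % 4 = 3) :
    (∃ S, T = (4 : ℤ) • S ∧ KrausTwo (d • S)) ↔
      4096 ∣ T.Δ ∧ (16 ∣ T.c₄ ∧ ¬ 32 ∣ T.c₄) ∧ (64 ∣ T.c₆ ∧ ¬ 128 ∣ T.c₆) ∧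
          T.c₆ / 64 * d % 4 = 3 ∨
        256 ∣ T.c₄ ∧ (512 ∣ T.c₆ ∧ ¬ 1024 ∣ T.c₆) ∧ (4096 ∣ T.Δ ∧ ¬ 8192 ∣ T.Δ) ∧
          T.c₆ / 512 * d % 4 = 1 := by
  obtain ⟨q, rfl⟩ : ∃ q, d = 4 * q - 1 := ⟨d / 4 + 1, by omega⟩
  have hq (x : ℤ) : x * (4 * q - 1) = 4 * (x * q) - x := by ring
  rw [hq, hq]
  constructor
  · rintro ⟨S, rfl, hS⟩
    have hS' : ¬ KrausTwo S := mt krausAt_two_iff.mpr (hT.2 S (by norm_num))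
    rw [KrausTwo] at hS'
    rw [krausTwo_smul_iff_of_odd (by omega), hq, hq] at hS
    simp only [smul_c₄, smul_c₆, smul_Δ]
    rw [show (4 : ℤ) ^ 3 * S.c₆ / 64 = S.c₆ by omega,
      show (4 : ℤ) ^ 3 * S.c₆ / 512 = S.c₆ / 8 by omega]
    rcases hS with h₆ | ⟨h₄, h₆, _⟩
    · have := @odd_c₄_of_odd_c₆ S (by omega)
      exact Or.inl ⟨by omega, by omega, by omega, h₆⟩
    · have := not_two_dvd_Δ h₄ h₆ (by omega)
      exact Or.inr ⟨by omega, by omega, by omega, by omega⟩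
  · intro h
    obtain ⟨S, rfl⟩ : ∃ S, T = (4 : ℤ) • S :=
      (exists_eq_smul_iff four_ne_zero).mpr ⟨by omega, by omega, by omega⟩
    refine ⟨S, rfl, ?_⟩
    rw [krausTwo_smul_iff_of_odd (by omega), hq, hq]
    simp only [smul_c₄, smul_c₆, smul_Δ] at h
    rw [show (4 : ℤ) ^ 3 * S.c₆ / 64 = S.c₆ by omega,
      show (4 : ℤ) ^ 3 * S.c₆ / 512 = S.c₆ / 8 by omega] at h
    omega

theorem krausTwo_two_smul_smul_iff {T : Invariants ℤ} (hT : KrausTwo T) {w : ℤ} (hw : ¬ 2 ∣ w) :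
    KrausTwo ((2 * w) • T) ↔ 2 ∣ T.c₆ := by
  have := @odd_c₄_of_odd_c₆ T
  rw [mul_comm, mul_smul, krausTwo_smul_iff_of_odd hw, smul_c₄, smul_c₆,
    show (2 : ℤ) ^ 3 * T.c₆ / 8 = T.c₆ by omega, mul_assoc]
  rw [KrausTwo] at hT
  have : 2 ∣ T.c₆ → T.c₆ * w % 4 = 0 := by
    intro h
    obtain ⟨c, hc⟩ : 4 ∣ T.c₆ := by omega
    rw [hc, mul_assoc]; omega
  omega

theorem exists_eq_eight_smul_iff {T : Invariants ℤ} (hT : IsMinimalAt 2 T) {w : ℤ}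
    (hw : ¬ 2 ∣ w) :
    (∃ S, T = (8 : ℤ) • S ∧ KrausTwo (w • S)) ↔
      262144 ∣ T.Δ ∧ (64 ∣ T.c₄ ∧ ¬ 128 ∣ T.c₄) ∧ (512 ∣ T.c₆ ∧ ¬ 1024 ∣ T.c₆) ∧
        T.c₆ / 512 * w % 4 = 3 := by
  constructor
  · rintro ⟨S, rfl, hS⟩
    have hS' : ¬ KrausTwo ((2 : ℤ) • S) := mt krausAt_two_iff.mpr
      (hT.2 _ (by rw [smul_smul]; norm_num))
    rw [KrausTwo, smul_c₄, smul_c₆] at hS'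
    rw [krausTwo_smul_iff_of_odd hw] at hS
    have h2 : 2 ∣ S.c₆ * w ↔ 2 ∣ S.c₆ := by rw [mul_comm]; exact two_pow_dvd_mul_iff hw 1
    have := @odd_c₄_of_odd_c₆ S
    simp only [smul_c₄, smul_c₆, smul_Δ]
    rw [show (8 : ℤ) ^ 3 * S.c₆ / 512 = S.c₆ by omega]
    omega
  · intro h
    obtain ⟨S, rfl⟩ : ∃ S, T = (8 : ℤ) • S :=
      (exists_eq_smul_iff (by norm_num)).mpr ⟨by omega, by omega, by omega⟩
    refine ⟨S, rfl, (krausTwo_smul_iff_of_odd hw).mpr (Or.inl ?_)⟩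
    rw [smul_c₆, show (8 : ℤ) ^ 3 * S.c₆ / 512 = S.c₆ by omega] at h
    omega

theorem exists_eq_two_smul_iff {T : Invariants ℤ} (hT : KrausTwo T) (h₆ : 2 ∣ T.c₆) {w : ℤ}
    (hw : ¬ 2 ∣ w) :
    (∃ S, T = (2 : ℤ) • S ∧ KrausTwo (w • S)) ↔
      ¬ ((16 ∣ T.c₄ ∧ ¬ 64 ∣ T.c₄) ∨
        (8 ∣ T.c₆ ∧ ¬ 16 ∣ T.c₆ ∨ 32 ∣ T.c₆ ∧ ¬ 64 ∣ T.c₆ ∨ 128 ∣ T.c₆ ∧ ¬ 256 ∣ T.c₆) ∨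
        64 ∣ T.c₄ ∧ (64 ∣ T.c₆ ∧ ¬ 128 ∣ T.c₆) ∧ (64 ∣ T.Δ ∧ ¬ 128 ∣ T.Δ) ∧
          T.c₆ / 64 * w % 4 = 3) := by
  have h2 (x : ℤ) : 2 ∣ x * w ↔ 2 ∣ x := by rw [mul_comm]; exact two_pow_dvd_mul_iff hw 1
  have h4 (x : ℤ) : 4 ∣ x * w ↔ 4 ∣ x := by rw [mul_comm]; exact two_pow_dvd_mul_iff hw 2
  have h₄ : 16 ∣ T.c₄ := by rw [KrausTwo] at hT; omega
  constructor
  · rintro ⟨S, rfl, hS⟩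
    simp only [smul_c₄, smul_c₆, smul_Δ] at h₄ ⊢
    have h₆' : 2 ∣ S.c₆ := not_not.mp (mt odd_c₄_of_odd_c₆ (by omega))
    have := h2 S.c₆
    rw [krausTwo_smul_iff_of_odd hw, or_iff_right (by omega)] at hS
    obtain ⟨b, hb⟩ := hS.2.1
    rw [show (2 : ℤ) ^ 3 * S.c₆ / 64 = b by omega]
    rw [show S.c₆ / 8 = b by omega] at hS
    have := h2 b
    have := h4 b
    rintro (h | h | h) <;> omega
  · intro h
    have h₆' : 64 ∣ T.c₆ := by rw [KrausTwo] at hT; omega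
    have h₄' : 64 ∣ T.c₄ := by omega
    obtain ⟨S, rfl⟩ : ∃ S, T = (2 : ℤ) • S :=
      (exists_eq_smul_iff two_ne_zero).mpr ⟨by omega, by omega, sixtyFour_dvd_Δ h₄' h₆'⟩
    simp only [smul_c₄, smul_c₆, smul_Δ] at h h₄' h₆'
    rw [show (2 : ℤ) ^ 3 * S.c₆ / 64 = S.c₆ / 8 by omega] at h
    refine ⟨S, rfl, (krausTwo_smul_iff_of_odd hw).mpr (Or.inr ⟨by omega, by omega, ?_⟩)⟩
    have := @not_two_dvd_Δ S
    have := h2 (S.c₆ / 8)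
    have := h4 (S.c₆ / 8)
    omega

theorem six_le_lam_iff (V : WeierstrassCurve ℤ) (p : ℕ) [Fact p.Prime] :
    6 ≤ lam (V.map (Int.castRingHom ℚ)) p ↔ ∃ S, ofCurve V = (p : ℤ) • S := by
  have hp0 : (p : ℤ) ≠ 0 := Nat.cast_ne_zero.mpr (Fact.out : p.Prime).ne_zero
  have mul_le_nsmul_iff (k n : ℕ) (hk : k ≠ 0) (x : WithTop ℤ) :
      ((k * n : ℕ) : ℤ) ≤ k • x ↔ ((n : ℤ) : WithTop ℤ) ≤ x := by
    cases x with
    | top =>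
      obtain ⟨k, rfl⟩ := Nat.exists_eq_succ_of_ne_zero hk
      simp [succ_nsmul]
    | coe x =>
      rw [← WithTop.coe_nsmul, WithTop.coe_le_coe, WithTop.coe_le_coe, nsmul_eq_mul]
      push_cast
      exact mul_le_mul_iff_of_pos_left (by exact_mod_cast Nat.pos_of_ne_zero hk)
  rw [lam, le_min_iff, le_min_iff, exists_eq_smul_iff hp0, WeierstrassCurve.map_c₄,
    WeierstrassCurve.map_c₆, WeierstrassCurve.map_Δ, eq_intCast, eq_intCast, eq_intCast]
  exact and_congr ((mul_le_nsmul_iff 3 2 three_ne_zero _).trans (natCast_le_vp_iff 2 _))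
    (and_congr ((mul_le_nsmul_iff 2 3 two_ne_zero _).trans (natCast_le_vp_iff 3 _))
      (natCast_le_vp_iff 6 _))

theorem exists_eq_prime_smul_iff (V : WeierstrassCurve ℤ) {p : ℕ} [Fact p.Prime] (hp2 : p ≠ 2) :
    (∃ S, ofCurve V = (p : ℤ) • S ∧ KrausAt p S) ↔
      ¬ (lam (V.map (Int.castRingHom ℚ)) p < 6 ∨
        p = 3 ∧ vp p (V.map (Int.castRingHom ℚ)).c₆ = 5) := by
  rw [not_or, not_lt, six_le_lam_iff, ← exists_and_right]
  refine exists_congr fun S => and_congr_right fun hS => ?_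
  rw [KrausAt, and_iff_right (fun h => absurd h hp2), not_and]
  refine forall_congr' ?_
  rintro rfl
  have h₆ : V.c₆ = 3 ^ 3 * S.c₆ := congrArg c₆ hS
  rw [WeierstrassCurve.map_c₆, eq_intCast, vp_eq_ofNat_iff, KrausThree]
  push_cast
  omega

/-- Integral invariants `T` can be divided by `(n⁴, n⁶, n¹²)` without violating Kraus's condition
at `p`. -/
def Admissible (p : ℕ) (n : ℤ) (T : Invariants ℤ) : Prop :=
  ∃ S : Invariants ℤ, T = n ^ 2 • S ∧ KrausAt p S

/-- A change of variables with scaling factor `u` turns the invariants `T` into integral ones that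
are minimal at `p`. -/
def IsScalingFactor (p : ℕ) (u : ℚ) (T : Invariants ℤ) : Prop :=
  ∃ S : Invariants ℤ, IsMinimalAt p S ∧
    T.map (Int.castRingHom ℚ) = u ^ 2 • S.map (Int.castRingHom ℚ)

theorem isMinimalAt_iff_not_admissible {p : ℕ} {T : Invariants ℤ} :
    IsMinimalAt p T ↔ KrausAt p T ∧ ¬ Admissible p p T := by
  simp only [IsMinimalAt, Admissible, not_exists, not_and]

theorem IsMinimalAt.isScalingFactor_one {p : ℕ} {T : Invariants ℤ} (h : IsMinimalAt p T) :
    IsScalingFactor p 1 T :=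
  ⟨T, h, by rw [one_pow, one_smul]⟩

theorem isScalingFactor_of_admissible {p : ℕ} {n : ℤ} {T : Invariants ℤ} (h : Admissible p n T)
    (h' : ¬ Admissible p (n * p) T) : IsScalingFactor p n T := by
  obtain ⟨S, rfl, hS⟩ := h
  refine ⟨S, ⟨hS, ?_⟩, ?_⟩
  · rintro S' rfl hS'
    exact h' ⟨S', by rw [smul_smul, mul_pow], hS'⟩
  · rw [Invariants.map_smul, map_pow, eq_intCast]

theorem isScalingFactor_inv {p : ℕ} [hp : Fact p.Prime] {T : Invariants ℤ} (hT : ¬ KrausAt p T) :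
    IsScalingFactor p (p : ℚ)⁻¹ T := by
  have hp0 : (p : ℚ) ≠ 0 := Nat.cast_ne_zero.mpr hp.out.ne_zero
  refine ⟨(p : ℤ) ^ 2 • T, isMinimalAt_prime_sq_smul hT, ?_⟩
  rw [Invariants.map_smul, smul_smul, map_pow, eq_intCast, Int.cast_natCast, ← mul_pow,
    inv_mul_cancel₀ hp0, one_pow, one_smul]

theorem admissible_smul_iff {p : ℕ} {n g v w : ℤ} {T : Invariants ℤ} (hn : n ^ 2 = g * v)
    (hn0 : n ≠ 0) (hvw : IsCoprime v w) :
    Admissible p n ((g * w) • T) ↔ ∃ S, T = v • S ∧ KrausAt p (w • S) := by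
  have hgv : g * v ≠ 0 := hn ▸ pow_ne_zero 2 hn0
  constructor
  · rintro ⟨S, hS, hk⟩
    rw [hn, mul_smul, mul_smul] at hS
    obtain ⟨S', rfl, rfl⟩ := exists_smul_eq_of_isCoprime (right_ne_zero_of_mul hgv) hvw
      (smul_right_injective (left_ne_zero_of_mul hgv) hS)
    exact ⟨S', rfl, hk⟩
  · rintro ⟨S, rfl, hk⟩
    exact ⟨w • S, by rw [hn, smul_smul, smul_smul, mul_right_comm], hk⟩

theorem IsMinimalAt.not_admissible_smul {p : ℕ} {n g v w : ℤ} {T : Invariants ℤ}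
    (hT : IsMinimalAt p T) (hn : n ^ 2 = g * (p ^ 2 * v)) (hn0 : n ≠ 0) (hv : (p : ℤ) ∣ v)
    (hv2 : p = 2 → 4 ∣ v) (hw : IsCoprime (p ^ 2 * v) w) :
    ¬ Admissible p n ((g * w) • T) := by
  rw [admissible_smul_iff hn hn0 hw]
  rintro ⟨S, rfl, -⟩
  exact hT.2 (v • S) (mul_smul _ _ _) (krausAt_smul_of_dvd hv hv2 S)

theorem not_dvd_of_squarefree_mul {p : ℕ} [hp : Fact p.Prime] {w : ℤ}
    (h : Squarefree ((p : ℤ) * w)) : ¬ (p : ℤ) ∣ w :=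
  fun hw => (Nat.prime_iff_prime_int.mp hp.out).not_isUnit (h p (mul_dvd_mul_left _ hw))

theorem isScalingFactor_oddFactor {V : WeierstrassCurve ℤ} {p : ℕ} [hp : Fact p.Prime]
    (hp2 : p ≠ 2) (hV : IsMinimalAt p (ofCurve V)) {d : ℤ} (hd : Squarefree d) :
    IsScalingFactor p (oddFactor (V.map (Int.castRingHom ℚ)) d p) (d • ofCurve V) := by
  have hp0 : (p : ℤ) ≠ 0 := Nat.cast_ne_zero.mpr hp.out.ne_zero
  rw [oddFactor]
  by_cases hpd : (p : ℤ) ∣ d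
  · obtain ⟨w, rfl⟩ := hpd
    have hw : UnramifiedAt p w := ⟨not_dvd_of_squarefree_mul hd, fun h => absurd h hp2⟩
    have hadm : Admissible p p ((p * w) • ofCurve V) ↔ _ :=
      (admissible_smul_iff (sq _) hp0 hw.isCoprime).trans
        ((exists_congr fun S => and_congr_right' (krausAt_smul_iff hw)).trans
          (exists_eq_prime_smul_iff V hp2))
    have hnot : ¬ Admissible p (p * p) ((p * w) • ofCurve V) :=
      hV.not_admissible_smul (v := p) (by ring) (mul_ne_zero hp0 hp0) dvd_rfl
        (fun h => absurd h hp2) (hw.isCoprime.pow_left.mul_left hw.isCoprime)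
    rw [if_pos (dvd_mul_right _ _)]
    split_ifs with h
    · exact (isMinimalAt_iff_not_admissible.mpr ⟨krausAt_smul_of_dvd (dvd_mul_right _ _)
        (fun h => absurd h hp2) _, hadm.not_left.mpr h⟩).isScalingFactor_one
    · exact isScalingFactor_of_admissible (hadm.mpr h) hnot
  · rw [if_neg hpd]
    exact ((isMinimalAt_smul_iff ⟨hpd, fun h => absurd h hp2⟩).mpr hV).isScalingFactor_one

theorem isScalingFactor_twoFactorOfThreeModFour {V : WeierstrassCurve ℤ}
    (hV : IsMinimalAt 2 (ofCurve V)) {d : ℤ} (hd : d % 4 = 3) :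
    IsScalingFactor 2 (twoFactorOfThreeModFour (V.map (Int.castRingHom ℚ)) d) (d • ofCurve V) := by
  have hd2 : IsCoprime 2 d := Int.prime_two.coprime_iff_not_dvd.mpr (by omega)
  have hhalf := not_krausTwo_smul_iff_of_three_mod_four (krausAt_two_iff.mp hV.1) hd
  have htwo : Admissible 2 2 (d • ofCurve V) ↔
      ∃ S, ofCurve V = (4 : ℤ) • S ∧ KrausTwo (d • S) := by
    simpa only [one_mul, krausAt_two_iff] using admissible_smul_iff (p := 2) (g := 1) (v := 4)
      (by norm_num) two_ne_zero (hd2.pow_left (m := 2))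
  have hnot_four : ¬ Admissible 2 4 (d • ofCurve V) := by
    simpa only [one_mul] using hV.not_admissible_smul (g := 1) (v := 4) (by norm_num) four_ne_zero
      (by norm_num) (by norm_num) (hd2.pow_left (m := 4))
  rw [exists_eq_four_smul_iff_of_three_mod_four hV hd] at htwo
  rw [← krausAt_two_iff] at hhalf
  rw [twoFactorOfThreeModFour_map]
  split_ifs with h₁ h₂
  · simpa using isScalingFactor_inv (hhalf.mpr h₁)
  · exact isScalingFactor_of_admissible (htwo.mpr h₂) hnot_four
  · exact (isMinimalAt_iff_not_admissible.mpr
      ⟨hhalf.not_right.mpr h₁, htwo.not.mpr h₂⟩).isScalingFactor_one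

theorem isScalingFactor_twoFactorOfTwoModFour {V : WeierstrassCurve ℤ}
    (hV : IsMinimalAt 2 (ofCurve V)) {w : ℤ} (hw : ¬ 2 ∣ w) :
    IsScalingFactor 2 (twoFactorOfTwoModFour (V.map (Int.castRingHom ℚ)) (2 * w))
      ((2 * w) • ofCurve V) := by
  have hw2 : IsCoprime 2 w := Int.prime_two.coprime_iff_not_dvd.mpr hw
  have hKraus := krausTwo_two_smul_smul_iff (krausAt_two_iff.mp hV.1) hw
  have htwo : Admissible 2 2 ((2 * w) • ofCurve V) ↔
      ∃ S, ofCurve V = (2 : ℤ) • S ∧ KrausTwo (w • S) := by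
    simpa only [krausAt_two_iff] using admissible_smul_iff (p := 2) (by norm_num) two_ne_zero hw2
  have hfour : Admissible 2 4 ((2 * w) • ofCurve V) ↔
      ∃ S, ofCurve V = (8 : ℤ) • S ∧ KrausTwo (w • S) := by
    simpa only [krausAt_two_iff] using admissible_smul_iff (p := 2) (v := 8) (by norm_num)
      four_ne_zero (hw2.pow_left (m := 3))
  have hnot_eight : ¬ Admissible 2 8 ((2 * w) • ofCurve V) :=
    hV.not_admissible_smul (v := 8) (by norm_num) (by norm_num) (by norm_num) (by norm_num)
      (hw2.pow_left (m := 5))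
  rw [exists_eq_eight_smul_iff hV hw] at hfour
  rw [← krausAt_two_iff] at hKraus
  rw [twoFactorOfTwoModFour_map]
  split_ifs with h₁ h₂ h₃
  · simpa using isScalingFactor_inv (hKraus.not.mpr h₁.2)
  · exact isScalingFactor_of_admissible (hfour.mpr h₂) hnot_eight
  all_goals
    have h₆ : 2 ∣ (ofCurve V).c₆ := by
      by_contra h
      exact h₁ ⟨odd_c₄_of_odd_c₆ h, h⟩
    rw [exists_eq_two_smul_iff (krausAt_two_iff.mp hV.1) h₆ hw] at htwo
  · exact (isMinimalAt_iff_not_admissible.mpr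
      ⟨hKraus.mpr h₆, htwo.not_left.mpr h₃⟩).isScalingFactor_one
  · exact isScalingFactor_of_admissible (htwo.mpr h₃) (hfour.not.mpr h₂)

theorem isScalingFactor_localFactor {V : WeierstrassCurve ℤ} {p : ℕ} [Fact p.Prime]
    (hV : IsMinimalAt p (ofCurve V)) {d : ℤ} (hd : Squarefree d) :
    IsScalingFactor p (localFactor (V.map (Int.castRingHom ℚ)) d p) (d • ofCurve V) := by
  rw [localFactor]
  split_ifs with hp h₁ h₃
  · subst hp
    exact ((isMinimalAt_smul_iff ⟨by have := h₁.eq; omega, fun _ => h₁⟩).mpr hV).isScalingFactor_one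
  · subst hp
    exact isScalingFactor_twoFactorOfThreeModFour hV h₃
  · subst hp
    obtain ⟨w, rfl⟩ : 2 ∣ d := by simp only [Int.ModEq] at h₁ h₃; omega
    exact isScalingFactor_twoFactorOfTwoModFour hV (not_dvd_of_squarefree_mul hd)
  · exact isScalingFactor_oddFactor hp hV hd

theorem exists_intCast_eq_of_padicValuation_le_one {x : ℚ}
    (h : ∀ (p : ℕ) [Fact p.Prime], Rat.padicValuation p x ≤ 1) : ∃ n : ℤ, (n : ℚ) = x := by
  refine ⟨x.num, (Rat.den_eq_one_iff x).mp ?_⟩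
  refine Nat.eq_one_iff_not_exists_prime_dvd.mpr fun p hp => ?_
  have : Fact p.Prime := ⟨hp⟩
  exact Rat.padicValuation_le_one_iff.mp (h p)

theorem exists_map_eq_of_padicValuation_le_one {T : Invariants ℚ}
    (h : ∀ (p : ℕ) [Fact p.Prime], Rat.padicValuation p T.c₄ ≤ 1 ∧
      Rat.padicValuation p T.c₆ ≤ 1 ∧ Rat.padicValuation p T.Δ ≤ 1) :
    ∃ S : Invariants ℤ, S.map (Int.castRingHom ℚ) = T := by
  obtain ⟨A, hA⟩ := exists_intCast_eq_of_padicValuation_le_one fun p _ => (h p).1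
  obtain ⟨B, hB⟩ := exists_intCast_eq_of_padicValuation_le_one fun p _ => (h p).2.1
  obtain ⟨D, hD⟩ := exists_intCast_eq_of_padicValuation_le_one fun p _ => (h p).2.2
  have hrel := T.relation
  rw [← hA, ← hB, ← hD] at hrel
  exact ⟨⟨A, B, D, by exact_mod_cast hrel⟩, Invariants.ext hA hB hD⟩

theorem isMinimalAt_of_map_eq_sq_smul {p : ℕ} [hp : Fact p.Prime] {S S' : Invariants ℤ}
    (hS : IsMinimalAt p S) {a : ℚ} (ha : Rat.padicValuation p a = 1)
    (h : S'.map (Int.castRingHom ℚ) = a ^ 2 • S.map (Int.castRingHom ℚ)) : IsMinimalAt p S' := by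
  have hden : ¬ (p : ℤ) ∣ a.den := by
    rw [Int.natCast_dvd_natCast]
    exact Rat.padicValuation_le_one_iff.mp ha.le
  have hnum : ¬ (p : ℤ) ∣ a.num := by
    rw [← Int.padicValuation_eq_one_iff] at hden ⊢
    rw [← Rat.padicValuation_cast] at hden ⊢
    rw [← Rat.mul_den_eq_num, map_mul, ha, one_mul]
    exact_mod_cast hden
  have hdiv : (a.den : ℤ) ^ 2 • S' = a.num ^ 2 • S := by
    refine map_injective (RingHom.injective_int (Int.castRingHom ℚ)) ?_
    rw [Invariants.map_smul, Invariants.map_smul, h, smul_smul, map_pow, map_pow, ← mul_pow,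
      eq_intCast, eq_intCast, Int.cast_natCast, mul_comm, Rat.mul_den_eq_num]
  rw [← isMinimalAt_sq_smul_iff hden, hdiv]
  exact (isMinimalAt_sq_smul_iff hnum).mpr hS

theorem exists_map_eq_forall_isMinimalAt {T : Invariants ℚ}
    (h : ∀ (p : ℕ) [Fact p.Prime], ∃ (S : Invariants ℤ) (a : ℚ), IsMinimalAt p S ∧
      Rat.padicValuation p a = 1 ∧ T = a ^ 2 • S.map (Int.castRingHom ℚ)) :
    ∃ S : Invariants ℤ, S.map (Int.castRingHom ℚ) = T ∧
      ∀ (p : ℕ) [Fact p.Prime], IsMinimalAt p S := by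
  have hle (k p : ℕ) [Fact p.Prime] (a : ℚ) (ha : Rat.padicValuation p a = 1) (x : ℤ) :
      Rat.padicValuation p ((a ^ 2) ^ k * x) ≤ 1 := by
    rw [map_mul, map_pow, map_pow, ha, one_pow, one_pow, one_mul, Rat.padicValuation_cast]
    exact Int.padicValuation_le_one p x
  obtain ⟨S, rfl⟩ : ∃ S : Invariants ℤ, S.map (Int.castRingHom ℚ) = T := by
    refine exists_map_eq_of_padicValuation_le_one fun p _ => ?_
    obtain ⟨S, a, -, ha, rfl⟩ := h p
    exact ⟨hle 2 p a ha S.c₄, hle 3 p a ha S.c₆, hle 6 p a ha S.Δ⟩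
  refine ⟨S, rfl, fun p _ => ?_⟩
  obtain ⟨S', a, hS', ha, hSa⟩ := h p
  exact isMinimalAt_of_map_eq_sq_smul hS' ha hSa

theorem localFactor_eq_zpow (E : WeierstrassCurve ℚ) (d : ℤ) (p : ℕ) :
    ∃ k : ℤ, localFactor E d p = (p : ℚ) ^ k := by
  rw [localFactor, twoFactorOfThreeModFour, twoFactorOfTwoModFour, oddFactor]
  split_ifs with hp
  exacts [⟨0, by simp⟩, ⟨-1, by simp [hp]⟩, ⟨1, by simp [hp]⟩, ⟨0, by simp⟩, ⟨-1, by simp [hp]⟩,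
    ⟨2, by norm_num [hp]⟩, ⟨0, by simp⟩, ⟨1, by simp [hp]⟩, ⟨0, by simp⟩, ⟨1, by simp⟩,
    ⟨0, by simp⟩]

theorem localFactor_ne_zero (E : WeierstrassCurve ℚ) (d : ℤ) {p : ℕ} (hp : p ≠ 0) :
    localFactor E d p ≠ 0 := by
  obtain ⟨k, hk⟩ := localFactor_eq_zpow E d p
  exact hk ▸ zpow_ne_zero k (Nat.cast_ne_zero.mpr hp)

theorem padicValuation_localFactor_of_ne (E : WeierstrassCurve ℚ) (d : ℤ) {p q : ℕ}
    [hp : Fact p.Prime] (hq : q.Prime) (hpq : p ≠ q) :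
    Rat.padicValuation p (localFactor E d q) = 1 := by
  have hv : Rat.padicValuation p ((q : ℤ) : ℚ) = 1 := by
    rw [Rat.padicValuation_cast, Int.padicValuation_eq_one_iff, Int.natCast_dvd_natCast,
      Nat.prime_dvd_prime_iff_eq hp.out hq]
    exact hpq
  obtain ⟨k, hk⟩ := localFactor_eq_zpow E d q
  rw [hk, map_zpow₀, ← Int.cast_natCast, hv, one_zpow]

theorem padicValuation_uTilde (E : WeierstrassCurve ℚ) {d : ℤ} (hd : d ≠ 0) (p : ℕ)
    [hp : Fact p.Prime] :
    Rat.padicValuation p (uTilde E d) = Rat.padicValuation p (localFactor E d p) := by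
  rw [uTilde, map_finprod _ (finite_mulSupport_localFactor E hd)]
  refine finprod_eq_single _ (⟨p, hp.out⟩ : Nat.Primes) fun q hq => ?_
  exact padicValuation_localFactor_of_ne E d q.2 fun h => hq (Subtype.ext h.symm)

theorem uTilde_ne_zero (E : WeierstrassCurve ℚ) {d : ℤ} (hd : d ≠ 0) : uTilde E d ≠ 0 := by
  have hv := padicValuation_uTilde E hd 2
  rw [← (Rat.padicValuation 2).ne_zero_iff, hv, Valuation.ne_zero_iff]
  exact localFactor_ne_zero E d two_ne_zero

theorem exists_ofCurve_twist_eq_uTilde_smul {V : WeierstrassCurve ℤ}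
    (hV : ∀ (p : ℕ) [Fact p.Prime], IsMinimalAt p (ofCurve V)) {d : ℤ} (hd : Squarefree d) :
    ∃ V' : WeierstrassCurve ℤ, (∀ (p : ℕ) [Fact p.Prime], IsMinimalAt p (ofCurve V')) ∧
      ofCurve (twist (V.map (Int.castRingHom ℚ)) d) =
        uTilde (V.map (Int.castRingHom ℚ)) d ^ 2 • ofCurve (V'.map (Int.castRingHom ℚ)) := by
  let u := uTilde (V.map (Int.castRingHom ℚ)) d
  have hu : u ≠ 0 := uTilde_ne_zero _ hd.ne_zero
  obtain ⟨S, hS, hmin⟩ := exists_map_eq_forall_isMinimalAt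
    (T := u⁻¹ ^ 2 • (d • ofCurve V).map (Int.castRingHom ℚ)) fun p _ => by
      obtain ⟨S, hS, hTS⟩ := isScalingFactor_localFactor (hV p) hd
      refine ⟨S, u⁻¹ * localFactor (V.map (Int.castRingHom ℚ)) d p, hS, ?_, ?_⟩
      · rw [map_mul, map_inv₀, ← padicValuation_uTilde _ hd.ne_zero,
          inv_mul_cancel₀ ((Valuation.ne_zero_iff _).mpr hu)]
      · rw [hTS, smul_smul, mul_pow]
  obtain ⟨V', rfl⟩ := exists_ofCurve_eq fun p _ => (hmin p).1
  refine ⟨V', hmin, ?_⟩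
  rw [ofCurve_twist, ofCurve_map, ofCurve_map, hS, smul_smul, ← mul_pow, mul_inv_cancel₀ hu,
    one_pow, one_smul, Invariants.map_smul, eq_intCast]

end QuadraticTwist

theorem mainTheorem2 (E : WeierstrassCurve ℚ) [E.IsElliptic]
    (hE : QuadraticTwist.IsGlobalMinimal E) (d : ℤ) (hd : Squarefree d) :
    ∃ (u : ℚˣ) (r s t : ℚ), (u : ℚ) = QuadraticTwist.uTilde E d ∧
      QuadraticTwist.IsGlobalMinimal
        ((⟨u, r, s, t⟩ : WeierstrassCurve.VariableChange ℚ) • QuadraticTwist.twist E d) := by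
  obtain ⟨V, rfl⟩ : ∃ V : WeierstrassCurve ℤ, E = V.map (Int.castRingHom ℚ) := hE.1.integral
  have hΔ : (V.map (Int.castRingHom ℚ)).Δ ≠ 0 := WeierstrassCurve.isUnit_Δ _ |>.ne_zero
  have hV := (QuadraticTwist.isGlobalMinimal_map_iff (by simpa using hΔ)).mp hE
  obtain ⟨V', hV', htwist⟩ := QuadraticTwist.exists_ofCurve_twist_eq_uTilde_smul hV hd
  have hu := QuadraticTwist.uTilde_ne_zero (V.map (Int.castRingHom ℚ)) hd.ne_zero
  have hΔ' : V'.Δ ≠ 0 := by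
    intro h0
    exact mul_ne_zero (pow_ne_zero 6 (Int.cast_ne_zero.mpr hd.ne_zero)) hΔ <|
      (congrArg QuadraticTwist.Invariants.Δ
        ((QuadraticTwist.ofCurve_twist _ d).symm.trans htwist)).trans (by simp [h0])
  obtain ⟨r, s, t, h⟩ := QuadraticTwist.exists_variableChange two_ne_zero three_ne_zero
    (Units.mk0 _ hu) htwist
  exact ⟨Units.mk0 _ hu, r, s, t, rfl, h ▸ (QuadraticTwist.isGlobalMinimal_map_iff hΔ').mpr hV'⟩
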